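/- Let $p$ be a prime and let $F$ be a field which contains a primitive $p$-th root of unity if $p$ is odd, and a primitive fourth root of unity if $p=2$. Let $G_F(p)$ be the maximal pro-$p$ quotient of the absolute Galois group $\mathrm{Gal}(F_{sep}/F)$. Let $S$ be a free pro-$p$ group on a set of generators $\{x\}\cup\{y_i\mid i\in I\}$ (where $x$ and the $y_i$ are distinct; for infinite $I$ the generators converge to $1$, as usual), and let $$1\longrightarrow R\longrightarrow S\stackrel{\pi}{\longrightarrow} G_F(p)\longrightarrow 1$$ be a minimal presentation of $G_F(p)$, that is, $\pi$ is a continuous surjective homomorphism with kernel $R\subseteq S^p[S,S]$. For closed subgroups $H,K$ of $S$, let $[H,K]$ be the smallest closed subgroup containing all $[h,k]=hkh^{-1}k^{-1}$ with $h\in H$, $k\in K$, and let $H^p$ be the smallest closed subgroup containing all $h^p$ with $h\in H$. Let $S^{(1)}=S$ and $S^{(i+1)}=(S^{(i)})^p[S^{(i)},S]$ for $i\ge 1$ (the $p$-descending central series of $S$). Let $T$ be the closed subgroup of $S$ generated by $\{y_i\mid i\in I\}$. Then there is no relation $r\in R$ of the form $r=x^{p^{l-1}u}\,s\,t$, where $l$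 and $u$ are integers with $l\ge 2$ and $\gcd(p,u)=1$, $s\in[T,T]$ and $t\in S^{(l+1)}\cap[S,S]$. -/

import Mathlib

open Filter Topology

/-- The commutator `[H, K]` of two subgroups of a topological group: the smallest closed subgroup
containing all `x * y * x⁻¹ * y⁻¹` with `x ∈ H` and `y ∈ K`. -/
def closedCommutator {G : Type*} [Group G] [TopologicalSpace G] [IsTopologicalGroup G]
    (H K : Subgroup G) : Subgroup G :=
  (⁅H, K⁆).topologicalClosure

/-- The subgroup `H ^ p` of a topological group: the smallest closed subgroup containing all
`x ^ p` with `x ∈ H`. -/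
def closedPower {G : Type*} [Group G] [TopologicalSpace G] [IsTopologicalGroup G]
    (p : ℕ) (H : Subgroup G) : Subgroup G :=
  (Subgroup.closure {g : G | ∃ x ∈ H, g = x ^ p}).topologicalClosure

/-- The `p`-descending central series: `G^(1) = G` and `G^(i+1) = (G^(i))^p [G^(i), G]`.
(The value at the index `0`, which is not part of the series, is `G`.) -/
def pDescendingCentralSeries (p : ℕ) (G : Type*) [Group G] [TopologicalSpace G]
    [IsTopologicalGroup G] : ℕ → Subgroup G
  | 0 => ⊤
  | 1 => ⊤
  | i + 2 =>
    closedPower p (pDescendingCentralSeries p G (i + 1)) ⊔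
      closedCommutator (pDescendingCentralSeries p G (i + 1)) ⊤

/-- A topological group is a pro-`p` group if it is profinite and all its open normal subgroups
have index a power of `p`. -/
structure IsProPGroup (p : ℕ) (G : Type*) [Group G] [TopologicalSpace G]
    [IsTopologicalGroup G] : Prop where
  compactSpace : CompactSpace G
  t2Space : T2Space G
  totallyDisconnectedSpace : TotallyDisconnectedSpace G
  index_eq : ∀ N : Subgroup G, N.Normal → IsOpen (N : Set G) → ∃ n : ℕ, N.index = p ^ n

/-- A family of elements of a topological group converges to `1` if every neighbourhood of `1`
contains all but finitely many of its members. -/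
def ConvergesToOne {X G : Type*} [Group G] [TopologicalSpace G] (f : X → G) : Prop :=
  Tendsto f cofinite (𝓝 1)

universe u v

/-- `S` is a free pro-`p` group on the family `ι : X → S`: it is a pro-`p` group, the family
converges to `1`, and every family converging to `1` in a pro-`p` group `P`, indexed by `X`, is the
image of `ι` under exactly one continuous homomorphism `S → P`. -/
structure IsFreeProPGroupOn (p : ℕ) {S : Type v} [Group S] [TopologicalSpace S]
    [IsTopologicalGroup S] {X : Type u} (ι : X → S) : Prop where
  isProPGroup : IsProPGroup p S
  convergesToOne : ConvergesToOne ι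
  existsUnique_lift : ∀ (P : Type v) [Group P] [TopologicalSpace P] [IsTopologicalGroup P],
    IsProPGroup p P → ∀ f : X → P, ConvergesToOne f →
      ∃! φ : S →ₜ* P, ∀ a : X, φ (ι a) = f a

/-- The intersection of all open normal subgroups of `p`-power index. -/
def proPKernel (p : ℕ) (G : Type*) [Group G] [TopologicalSpace G] : Subgroup G :=
  sInf {N : Subgroup G | N.Normal ∧ IsOpen (N : Set G) ∧ ∃ n : ℕ, N.index = p ^ n}

instance proPKernel_normal (p : ℕ) (G : Type*) [Group G] [TopologicalSpace G] :
    (proPKernel p G).Normal := by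
  constructor
  intro g hg h
  rw [proPKernel, Subgroup.mem_sInf] at hg ⊢
  intro N hN
  exact hN.1.conj_mem g (hg N hN) h

/-- The maximal pro-`p` quotient of a profinite group, with the quotient topology. -/
abbrev MaximalProPQuotient (p : ℕ) (G : Type*) [Group G] [TopologicalSpace G] : Type _ :=
  G ⧸ proPKernel p G

/-- `G_F(p)`: the maximal pro-`p` quotient of the absolute Galois group of `F`. -/
abbrev maximalProPGaloisGroup (p : ℕ) (F : Type*) [Field F] : Type _ :=
  MaximalProPQuotient p (SeparableClosure F ≃ₐ[F] SeparableClosure F)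

/-- A continuous homomorphism `π : S → G` from a (free) pro-`p` group `S` is a minimal
presentation of `G` if it is surjective and its kernel lies in the Frattini subgroup
`S^p [S, S]` of `S`. -/
structure IsMinimalPresentation (p : ℕ) {S G : Type*} [Group S] [TopologicalSpace S]
    [IsTopologicalGroup S] [Group G] [TopologicalSpace G] (π : S →ₜ* G) : Prop where
  surjective : Function.Surjective π
  ker_le : π.toMonoidHom.ker ≤ closedPower p (⊤ : Subgroup S) ⊔ closedCommutator ⊤ ⊤

/-- The standing assumption on the roots of unity in the base field: a primitive `p`-th root of
unity if `p` is odd, a primitive fourth root of unity if `p = 2`. -/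
def RootsOfUnityCondition (p : ℕ) (F : Type*) [Field F] : Prop :=
  (p ≠ 2 → ∃ ζ : F, IsPrimitiveRoot ζ p) ∧ (p = 2 → ∃ ζ : F, IsPrimitiveRoot ζ 4)

/-!
Let `c` be the cyclotomic character of `G_F(p)` with values in `(ℤ/p^l)ˣ`. By Hilbert 90 and Kummer
theory, every continuous homomorphism `G_F(p) → ℤ/p` lifts to a continuous crossed homomorphism
`G_F(p) → ℤ/p^l` with respect to `c`. Successive approximation, which starts because `R` lies in the
Frattini subgroup of `S`, turns this into the vanishing on `R` of every continuous crossed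
homomorphism `S → ℤ/p^l`. As `S` is free, there is one with `x ↦ 1` and `y_i ↦ 0`. Its zero set is a
closed subgroup that contains `T` and `S^(l+1)`, while its value at `x^(p^(l-1) u)` is a unit times
`p^(l-1)`, hence not `0`; for `p = 2` this uses `c ≡ 1 mod 4`.
-/

theorem exists_geom_sum_eq {A : Type*} [CommRing A] {p : ℕ} (hp : p.Prime) {c : A}
    (hc : (p : A) ∣ c - 1) (hc2 : p = 2 → 4 ∣ c - 1) :
    ∃ e : A, ∑ i ∈ Finset.range p, c ^ i = p * (1 + p * e) := by
  rcases hp.eq_two_or_odd' with rfl | hodd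
  · obtain ⟨d, hd⟩ := hc2 rfl
    refine ⟨d, ?_⟩
    rw [eq_add_of_sub_eq hd]
    simp only [Finset.sum_range_succ, Finset.sum_range_zero, pow_zero, pow_one, Nat.cast_ofNat]
    ring
  · obtain ⟨d, hd⟩ := hc
    obtain ⟨e, he⟩ := odd_sq_dvd_geom_sum₂_sub (R := A) (a := 1) (b := d) hodd
    refine ⟨e, ?_⟩
    simp only [one_pow, mul_one] at he
    rw [eq_add_of_sub_eq hd, add_comm, eq_add_of_sub_eq he]
    ring

/-- Crossed homomorphisms (`1`-cocycles) from `G` to the ring `A`, on which `G` acts through the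
character `c`. For `c = 1` these are the homomorphisms from `G` to the additive group of `A`. -/
def IsCrossedHom {G A : Type*} [Group G] [CommRing A] (c : G →* Aˣ) (f : G → A) : Prop :=
  ∀ g h, f (g * h) = f g + c g * f h

namespace IsCrossedHom

section Algebra

variable {G A : Type*} [Group G] [CommRing A] {c : G →* Aˣ} {f : G → A}

theorem map_one (hf : IsCrossedHom c f) : f 1 = 0 := by
  simpa using hf 1 1

theorem map_inv (hf : IsCrossedHom c f) (g : G) : f g⁻¹ = -(((c g)⁻¹ : Aˣ) * f g) := by
  have h := hf g⁻¹ g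
  rw [inv_mul_cancel, hf.map_one, _root_.map_inv] at h
  linear_combination -h

theorem map_pow (hf : IsCrossedHom c f) (g : G) (n : ℕ) :
    f (g ^ n) = (∑ i ∈ Finset.range n, (c g : A) ^ i) * f g := by
  induction n with
  | zero => simp [hf.map_one]
  | succ n ih =>
    rw [pow_succ, hf, ih, Finset.sum_range_succ, _root_.map_pow, Units.val_pow_eq_pow_val]
    ring

theorem map_conj (hf : IsCrossedHom c f) (g h : G) :
    f (h * g * h⁻¹) = (1 - c g) * f h + c h * f g := by
  have e : f (h * g * h⁻¹ * h) = f (h * g) := by rw [inv_mul_cancel_right]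
  have hc : c (h * g * h⁻¹) = c g := by simp
  rw [hf, hf h g, hc] at e
  linear_combination e

open scoped commutatorElement in
theorem map_commutatorElement (hf : IsCrossedHom c f) (g h : G) :
    f ⁅g, h⁆ = (c g - 1) * f h - (c h - 1) * f g := by
  have e := hf g (h * g⁻¹ * h⁻¹)
  rw [hf.map_conj, hf.map_inv, _root_.map_inv] at e
  rw [commutatorElement_def, mul_assoc, mul_assoc, ← mul_assoc h, e]
  linear_combination (-(f h) - c h * f g) * (c g).mul_inv

theorem comp (hf : IsCrossedHom c f) {H : Type*} [Group H] (φ : H →* G) :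
    IsCrossedHom (c.comp φ) (f ∘ φ) := fun g h => by
  simp [hf (φ g) (φ h)]

theorem const_mul (hf : IsCrossedHom c f) (a : A) : IsCrossedHom c fun g => a * f g := fun g h => by
  simp only [hf g h]
  ring

theorem sub {f' : G → A} (hf : IsCrossedHom c f) (hf' : IsCrossedHom c f') :
    IsCrossedHom c fun g => f g - f' g := fun g h => by
  simp only [hf g h, hf' g h]
  ring

theorem isCrossedHom_one_pow_mul (hf : IsCrossedHom c f) {p : A} (hc : ∀ g, p ∣ (c g : A) - 1)
    {n : ℕ} (hn : ∀ g, p ^ (n + 1) * f g = 0) : IsCrossedHom 1 fun g => p ^ n * f g := by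
  intro g h
  obtain ⟨d, hd⟩ := hc g
  simp only [hf g h, eq_add_of_sub_eq hd, MonoidHom.one_apply, Units.val_one]
  linear_combination d * hn h

/-- The subgroup of the elements whose image under the crossed homomorphism `f` is divisible by `a`
and which act trivially modulo `b`. For `a = 0`, `b = 1` it is the zero set of `f`, and for
`a = b = 0` the kernel of the affine action of `G` on `A` that `f` defines. -/
def congruenceSubgroup (hf : IsCrossedHom c f) (a b : A) : Subgroup G where
  carrier := {g | a ∣ f g ∧ b ∣ (c g : A) - 1}
  one_mem' := by simp [hf.map_one]
  mul_mem' {g h} hg hh := by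
    refine ⟨hf g h ▸ dvd_add hg.1 (hh.1.mul_left _), ?_⟩
    have := dvd_add (hg.2.mul_right (c h : A)) hh.2
    rwa [sub_one_mul, sub_add_sub_cancel, ← Units.val_mul, ← map_mul] at this
  inv_mem' {g} hg := by
    refine ⟨hf.map_inv g ▸ (hg.1.mul_left _).neg_right, ?_⟩
    have := hg.2.mul_left (-((c g)⁻¹ : Aˣ) : A)
    rwa [mul_sub_one, neg_mul, Units.inv_mul, sub_neg_eq_add, neg_add_eq_sub,
      ← _root_.map_inv] at this

theorem mem_congruenceSubgroup {hf : IsCrossedHom c f} {a b : A} {g : G} :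
    g ∈ hf.congruenceSubgroup a b ↔ a ∣ f g ∧ b ∣ (c g : A) - 1 :=
  Iff.rfl

theorem mem_congruenceSubgroup_zero_one {hf : IsCrossedHom c f} {g : G} :
    g ∈ hf.congruenceSubgroup 0 1 ↔ f g = 0 := by
  simp [mem_congruenceSubgroup]

theorem mem_congruenceSubgroup_zero_zero {hf : IsCrossedHom c f} {g : G} :
    g ∈ hf.congruenceSubgroup 0 0 ↔ f g = 0 ∧ c g = 1 := by
  simp [mem_congruenceSubgroup, sub_eq_zero]

theorem normal_congruenceSubgroup (hf : IsCrossedHom c f) {a b : A} (h : a ∣ b) :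
    (hf.congruenceSubgroup a b).Normal where
  conj_mem g hg k := by
    refine ⟨?_, by simpa using hg.2⟩
    rw [hf.map_conj]
    exact dvd_add ((h.trans ((dvd_sub_comm).1 hg.2)).mul_right _) (hg.1.mul_left _)

theorem pow_mem_congruenceSubgroup (hf : IsCrossedHom c f) {p : ℕ} {a b : A} (hb : (p : A) ∣ b)
    {g : G} (hg : g ∈ hf.congruenceSubgroup a b) :
    g ^ p ∈ hf.congruenceSubgroup (p * a) (p * b) := by
  have hsum : (p : A) ∣ ∑ i ∈ Finset.range p, (c g : A) ^ i := by
    have h : ∑ i ∈ Finset.range p, (c g : A) ^ i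
        = ∑ i ∈ Finset.range p, ((c g : A) ^ i - 1) + p := by simp
    rw [h]
    exact dvd_add (Finset.dvd_sum fun i _ => (hb.trans hg.2).trans (sub_one_dvd_pow_sub_one _ i))
      dvd_rfl
  refine ⟨hf.map_pow g p ▸ mul_dvd_mul hsum hg.1, ?_⟩
  rw [_root_.map_pow, Units.val_pow_eq_pow_val, ← geom_sum_mul]
  exact mul_dvd_mul hsum hg.2

theorem pow_prime_pow_mem_congruenceSubgroup (hf : IsCrossedHom c f) {p : ℕ}
    (hc : ∀ g, (p : A) ∣ (c g : A) - 1) (g : G) (i : ℕ) :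
    g ^ p ^ i ∈ hf.congruenceSubgroup (p ^ i) (p ^ (i + 1)) := by
  induction i with
  | zero => simpa [mem_congruenceSubgroup] using hc g
  | succ i ih =>
    rw [pow_succ p, pow_mul, pow_succ' (p : A) i, pow_succ' (p : A) (i + 1)]
    exact hf.pow_mem_congruenceSubgroup (dvd_pow_self _ i.succ_ne_zero) ih

theorem pow_prime_pow_mem_congruenceSubgroup_zero_zero (hf : IsCrossedHom c f) {p l : ℕ}
    (hp : (p : A) ^ l = 0) (hc : ∀ g, (p : A) ∣ (c g : A) - 1) (g : G) :
    g ^ p ^ l ∈ hf.congruenceSubgroup 0 0 := by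
  simpa [pow_succ, hp] using hf.pow_prime_pow_mem_congruenceSubgroup hc g l

open scoped commutatorElement in
theorem commutatorElement_mem_congruenceSubgroup (hf : IsCrossedHom c f) {a b d : A}
    (hc : ∀ g, d ∣ (c g : A) - 1) {g : G} (hg : g ∈ hf.congruenceSubgroup a (d * a)) (h : G) :
    ⁅g, h⁆ ∈ hf.congruenceSubgroup (d * a) b := by
  refine ⟨?_, by simp [commutatorElement_eq_one_iff_mul_comm.2 (mul_comm (c g) (c h))]⟩
  rw [hf.map_commutatorElement]
  exact dvd_sub (hg.2.mul_right _) (mul_dvd_mul (hc h) hg.1)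

theorem exists_map_pow_prime_pow (hf : IsCrossedHom c f) {p : ℕ} (hp : p.Prime)
    (hc : ∀ g, (p : A) ∣ (c g : A) - 1) (hc2 : p = 2 → ∀ g, (4 : A) ∣ (c g : A) - 1)
    (g : G) (m : ℕ) : ∃ e : A, f (g ^ p ^ m) = p ^ m * (1 + p * e) * f g := by
  induction m with
  | zero => exact ⟨0, by simp⟩
  | succ m ih =>
    obtain ⟨e, he⟩ := ih
    obtain ⟨e', he'⟩ := exists_geom_sum_eq hp (hc (g ^ p ^ m)) fun h => hc2 h _
    refine ⟨e + e' + p * e * e', ?_⟩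
    rw [pow_succ, pow_mul, hf.map_pow, he', he]
    ring

end Algebra

end IsCrossedHom

section ClosedSubgroups

variable {G : Type*} [Group G] [TopologicalSpace G] [IsTopologicalGroup G]

theorem closedCommutator_le {H K L : Subgroup G} (hL : IsClosed (L : Set G)) (h : ⁅H, K⁆ ≤ L) :
    closedCommutator H K ≤ L :=
  Subgroup.topologicalClosure_minimal _ h hL

theorem closedPower_le {p : ℕ} {H L : Subgroup G} (hL : IsClosed (L : Set G))
    (h : ∀ g ∈ H, g ^ p ∈ L) : closedPower p H ≤ L :=
  Subgroup.topologicalClosure_minimal _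
    ((Subgroup.closure_le _).2 (by rintro _ ⟨g, hg, rfl⟩; exact h g hg)) hL

end ClosedSubgroups

namespace IsCrossedHom

section Topology

variable {G A : Type*} [Group G] [TopologicalSpace G] [CommRing A] {c : G →* Aˣ} {f : G → A}

theorem isOpen_congruenceSubgroup (hf : IsCrossedHom c f) (hfc : IsLocallyConstant f)
    (hc : IsLocallyConstant c) (a b : A) : IsOpen (hf.congruenceSubgroup a b : Set G) :=
  (hfc {z | a ∣ z}).inter (hc {z | b ∣ (z : A) - 1})

theorem exists_descend {S : Type*} [Group S] [TopologicalSpace S] {q : S →* G} {f : S → A}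
    (hf : IsCrossedHom (c.comp q) f) (hfc : IsLocallyConstant f) (hq : IsQuotientMap q)
    (hker : ∀ s ∈ q.ker, f s = 0) :
    ∃ f' : G → A, IsCrossedHom c f' ∧ IsLocallyConstant f' ∧ ∀ s, f' (q s) = f s := by
  have h_eq {s t : S} (hst : q s = q t) : f s = f t := by
    have h := hf t (t⁻¹ * s)
    have hts : t⁻¹ * s ∈ q.ker := by simp [MonoidHom.mem_ker, hst]
    rwa [mul_inv_cancel_left, hker _ hts, mul_zero, add_zero] at h
  let f' : G → A := fun g => f (Function.surjInv hq.surjective g)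
  have h (s : S) : f' (q s) = f s := h_eq (Function.surjInv_eq _ _)
  refine ⟨f', fun g k => ?_, fun U => hq.isOpen_preimage.1 ?_, h⟩
  · obtain ⟨s, rfl⟩ := hq.surjective g
    obtain ⟨t, rfl⟩ := hq.surjective k
    rw [← map_mul, h, h, h, hf, MonoidHom.comp_apply]
  · rw [← Set.preimage_comp, show f' ∘ q = f from funext h]
    exact hfc U

variable [IsTopologicalGroup G]

theorem frattini_le_congruenceSubgroup (hf : IsCrossedHom (1 : G →* Aˣ) f)
    (hfc : IsLocallyConstant f) {p : ℕ} (hp : ∀ g, p * f g = 0) :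
    closedPower p (⊤ : Subgroup G) ⊔ closedCommutator ⊤ ⊤ ≤ hf.congruenceSubgroup 0 1 := by
  have hclosed := Subgroup.isClosed_of_isOpen _
    (hf.isOpen_congruenceSubgroup hfc (IsLocallyConstant.const 1) 0 1)
  refine sup_le (closedPower_le hclosed fun g _ => ?_)
    (closedCommutator_le hclosed (Subgroup.commutator_le.2 fun g _ h _ => ?_))
  · simp [mem_congruenceSubgroup_zero_one, hf.map_pow, hp]
  · simp [mem_congruenceSubgroup_zero_one, hf.map_commutatorElement]

theorem pDescendingCentralSeries_le_congruenceSubgroup (hf : IsCrossedHom c f)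
    (hfc : IsLocallyConstant f) (hcc : IsLocallyConstant c) {p : ℕ}
    (hc : ∀ g, (p : A) ∣ (c g : A) - 1) (i : ℕ) :
    pDescendingCentralSeries p G (i + 1) ≤ hf.congruenceSubgroup (p ^ i) (p ^ (i + 1)) := by
  induction i with
  | zero => exact fun g _ => by simpa [mem_congruenceSubgroup] using hc g
  | succ i ih =>
    have hclosed := Subgroup.isClosed_of_isOpen _
      (hf.isOpen_congruenceSubgroup hfc hcc (p ^ (i + 1)) (p ^ (i + 2)))
    rw [pow_succ' (p : A) i] at ih
    rw [pow_succ' (p : A) i, pow_succ' (p : A) (i + 1), pow_succ' (p : A) i] at hclosed ⊢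
    exact sup_le
      (closedPower_le hclosed fun g hg => hf.pow_mem_congruenceSubgroup (dvd_mul_right _ _) (ih hg))
      (closedCommutator_le hclosed (Subgroup.commutator_le.2 fun g hg h _ =>
        hf.commutatorElement_mem_congruenceSubgroup hc (ih hg) h))

end Topology

end IsCrossedHom

/-- The group of the affine maps `z ↦ a * z + b` of `A` whose linear part `a` lies in `H`, as the
semidirect product of the translations and `H`. -/
abbrev AffineGroup {A : Type*} [CommRing A] (H : Subgroup Aˣ) : Type _ :=
  Multiplicative A ⋊[((MulAutMultiplicative A).symm.toMonoidHom.comp AddAut.mulLeft).comp H.subtype]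
    H

namespace AffineGroup

variable {A : Type*} [CommRing A] {H : Subgroup Aˣ}

instance [Finite A] : Finite (AffineGroup H) :=
  Finite.of_equiv _ SemidirectProduct.equivProd.symm

theorem isCrossedHom_left : IsCrossedHom (H.subtype.comp SemidirectProduct.rightHom)
    fun g : AffineGroup H => g.left.toAdd := fun _ _ => rfl

theorem isPGroup {p l : ℕ} (hp : (p : A) ^ l = 0) (hH : ∀ a ∈ H, (p : A) ∣ (a : A) - 1) :
    IsPGroup p (AffineGroup H) := fun g => by
  obtain ⟨hl, hr⟩ := IsCrossedHom.mem_congruenceSubgroup_zero_zero.1 <|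
    isCrossedHom_left.pow_prime_pow_mem_congruenceSubgroup_zero_zero hp (fun g => hH _ g.right.2) g
  exact ⟨l, SemidirectProduct.ext hl (Subtype.ext hr)⟩

end AffineGroup

section FreeProP

variable {p : ℕ} [Fact p.Prime]

theorem isProPGroup_of_isPGroup {G : Type*} [Group G] [TopologicalSpace G] [IsTopologicalGroup G]
    [Finite G] [DiscreteTopology G] (h : IsPGroup p G) : IsProPGroup p G where
  compactSpace := inferInstance
  t2Space := inferInstance
  totallyDisconnectedSpace := inferInstance
  index_eq N _ _ := h.index N

variable {S : Type v} [Group S] [TopologicalSpace S] [IsTopologicalGroup S] {X : Type u} {ι : X → S}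

-- The universal property only speaks of groups in the universe of `S`, whence the passage through
-- `Shrink`.
theorem IsFreeProPGroupOn.existsUnique_lift_finite (h : IsFreeProPGroupOn p ι) {P : Type*} [Group P]
    [Finite P] (hP : IsPGroup p P) (f : X → P) (hf : ∀ᶠ a in cofinite, f a = 1) :
    ∃! φ : S →* P, IsLocallyConstant φ ∧ ∀ a, φ (ι a) = f a := by
  have hsmall : Small.{v} P := Countable.toSmall P
  let E : Shrink.{v} P ≃* P := Shrink.mulEquiv
  let : TopologicalSpace (Shrink.{v} P) := ⊥
  have : DiscreteTopology (Shrink.{v} P) := ⟨rfl⟩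
  have : Finite (Shrink.{v} P) := Finite.of_equiv P E.symm
  have hf' : ConvergesToOne (fun a => E.symm (f a)) := by
    rw [ConvergesToOne, nhds_discrete]
    exact tendsto_pure.2 (hf.mono fun a ha => by rw [ha, map_one])
  obtain ⟨φ, hφ, huniq⟩ := h.existsUnique_lift _
    (isProPGroup_of_isPGroup (hP.of_equiv E.symm)) _ hf'
  refine ⟨E.toMonoidHom.comp φ.toMonoidHom, ⟨?_, fun a => ?_⟩, ?_⟩
  · exact ((IsLocallyConstant.iff_continuous φ).2 φ.continuous_toFun).comp E
  · change E (φ (ι a)) = f a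
    rw [hφ, E.apply_symm_apply]
  · rintro ψ ⟨hψ, hψ'⟩
    let ψ' : S →ₜ* Shrink.{v} P :=
      { E.symm.toMonoidHom.comp ψ with continuous_toFun := (hψ.comp E.symm).continuous }
    ext s
    change ψ s = E (φ s)
    rw [← huniq ψ' fun a => congrArg E.symm (hψ' a)]
    exact (E.apply_symm_apply _).symm

theorem IsFreeProPGroupOn.exists_isCrossedHom (hS : IsFreeProPGroupOn p ι) {A : Type*} [CommRing A]
    [Finite A] {l : ℕ} (hp : (p : A) ^ l = 0) {c : S →* Aˣ} (hcc : IsLocallyConstant c)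
    (hc : ∀ s, (p : A) ∣ (c s : A) - 1) (f₀ : X → A) (hf₀ : ∀ᶠ a in cofinite, f₀ a = 0) :
    ∃ f : S → A, IsCrossedHom c f ∧ IsLocallyConstant f ∧ ∀ a, f (ι a) = f₀ a := by
  have hP : IsPGroup p (AffineGroup c.range) :=
    AffineGroup.isPGroup hp (by rintro _ ⟨s, rfl⟩; exact hc s)
  have hι : ∀ᶠ a in cofinite, c (ι a) = 1 :=
    hS.convergesToOne.eventually (by simpa using hcc.eventually_eq 1)
  obtain ⟨φ, ⟨hφ, hφι⟩, -⟩ := hS.existsUnique_lift_finite hP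
    (fun a => ⟨.ofAdd (f₀ a), c.rangeRestrict (ι a)⟩) <| by
      filter_upwards [hf₀, hι] with a h₁ h₂
      exact SemidirectProduct.ext h₁ (Subtype.ext h₂)
  have hφc : SemidirectProduct.rightHom.comp φ = c.rangeRestrict :=
    (hS.existsUnique_lift_finite (hP.of_surjective _ SemidirectProduct.rightHom_surjective)
      (fun a => c.rangeRestrict (ι a)) (hι.mono fun a h => Subtype.ext h)).unique
      ⟨hφ.comp SemidirectProduct.rightHom, fun a => congrArg SemidirectProduct.right (hφι a)⟩
      ⟨IsLocallyConstant.desc _ Subtype.val hcc Subtype.val_injective, fun _ => rfl⟩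
  refine ⟨fun s => (φ s).left.toAdd, ?_, hφ.comp fun g => g.left.toAdd,
    fun a => congrArg (fun g => g.left.toAdd) (hφι a)⟩
  have h := AffineGroup.isCrossedHom_left.comp φ
  rwa [MonoidHom.comp_assoc, hφc, MonoidHom.subtype_comp_rangeRestrict] at h

end FreeProP

/-- The Kummer property of level `l` of a `p`-adic character `c` of `G` (one also says that `c` is
`1`-cyclotomic): every continuous additive character `χ` of `G` killed by `p` is `p ^ (l - 1)` times
a continuous crossed homomorphism. When `A` is `ℤ/p^l`, multiplication by `p ^ (l - 1)` identifies
`ℤ/p` with the `p`-torsion of `A`, so this says that the continuous homomorphisms from `G` to `ℤ/p`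
lift to continuous crossed homomorphisms from `G` to `ℤ/p^l`. -/
def IsKummerian {G A : Type*} [Group G] [TopologicalSpace G] [CommRing A] (p l : ℕ)
    (c : G →* Aˣ) : Prop :=
  ∀ χ : G → A, IsCrossedHom 1 χ → IsLocallyConstant χ → (∀ g, p * χ g = 0) →
    ∃ κ : G → A, IsCrossedHom c κ ∧ IsLocallyConstant κ ∧ ∀ g, p ^ (l - 1) * κ g = χ g

section Presentation

variable {p : ℕ} {S : Type*} [Group S] [TopologicalSpace S] [IsTopologicalGroup S]
  {G : Type*} [Group G] [TopologicalSpace G] [T2Space G] {π : S →ₜ* G}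
  {A : Type*} [CommRing A] {l : ℕ} {c : G →* Aˣ}

theorem IsMinimalPresentation.isQuotientMap [CompactSpace S] (hπ : IsMinimalPresentation p π) :
    IsQuotientMap π :=
  π.continuous_toFun.isClosedMap.isQuotientMap π.continuous_toFun hπ.surjective

-- Successive approximation: as the kernel of `π` lies in the Frattini subgroup, the leading term
-- `p ^ n * f` of a crossed homomorphism `f` killed by `p ^ (n + 1)` factors through `π`, and it can
-- be cancelled by a crossed homomorphism that factors through `π`.
theorem IsKummerian.eq_zero_of_mem_ker [CompactSpace S] (hG : IsKummerian p l c)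
    (hc : ∀ g, (p : A) ∣ (c g : A) - 1) (hπ : IsMinimalPresentation p π) {f : S → A}
    (hf : IsCrossedHom (c.comp π.toMonoidHom) f) (hfc : IsLocallyConstant f) {n : ℕ} (hnl : n ≤ l)
    (hn : ∀ s, (p : A) ^ n * f s = 0) {r : S} (hr : r ∈ π.toMonoidHom.ker) : f r = 0 := by
  induction n generalizing f with
  | zero => simpa using hn r
  | succ n ih =>
    have hχ := hf.isCrossedHom_one_pow_mul (fun s => hc (π s)) hn
    have hχc : IsLocallyConstant fun s => (p : A) ^ n * f s := hfc.comp _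
    have hχp (s : S) : p * ((p : A) ^ n * f s) = 0 := by rw [← mul_assoc, ← pow_succ', hn]
    have hχker (s : S) (hs : s ∈ π.toMonoidHom.ker) : (p : A) ^ n * f s = 0 :=
      (IsCrossedHom.mem_congruenceSubgroup_zero_one (hf := hχ)).1 <|
        hχ.frattini_le_congruenceSubgroup hχc hχp (hπ.ker_le hs)
    obtain ⟨χ, hχ', hχc', hχπ⟩ := IsCrossedHom.exists_descend (q := π.toMonoidHom) (c := 1)
      hχ hχc hπ.isQuotientMap hχker
    obtain ⟨κ, hκ, hκc, hκχ⟩ := hG χ hχ' hχc' <| hπ.surjective.forall.2 fun s =>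
      (congrArg _ (hχπ s)).trans (hχp s)
    have h := ih (hf.sub ((hκ.comp π.toMonoidHom).const_mul ((p : A) ^ (l - 1 - n))))
      (hfc.sub ((hκc.comp_continuous π.continuous_toFun).comp _)) (by omega) fun s => by
        rw [mul_sub, ← hχπ s, ← hκχ, ← mul_assoc, ← pow_add, Nat.add_sub_cancel' (by omega)]
        exact sub_self _
    have hr' : π r = 1 := hr
    simpa [hr', hκ.map_one] using h

theorem mem_of_zpow_mem_of_isCoprime {H : Type*} [Group H] {L : Subgroup H} {g : H} {a b : ℤ}
    (h : IsCoprime a b) (ha : g ^ a ∈ L) (hb : g ^ b ∈ L) : g ∈ L := by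
  obtain ⟨m, n, hmn⟩ := h
  rw [← zpow_one g, ← hmn, zpow_add, mul_comm m, mul_comm n, zpow_mul, zpow_mul]
  exact L.mul_mem (L.zpow_mem ha m) (L.zpow_mem hb n)

theorem IsCrossedHom.map_pow_prime_pow_pred_ne_zero {H : Type*} [Group H] {c : H →* Aˣ} {f : H → A}
    (hf : IsCrossedHom c f) (hp : p.Prime) (hpl : (p : A) ^ l = 0) (hpl' : (p : A) ^ (l - 1) ≠ 0)
    (hc : ∀ g, (p : A) ∣ (c g : A) - 1) (hc2 : p = 2 → ∀ g, (4 : A) ∣ (c g : A) - 1) {x : H}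
    (hx : f x = 1) : f (x ^ p ^ (l - 1)) ≠ 0 := by
  obtain ⟨e, he⟩ := hf.exists_map_pow_prime_pow hp hc hc2 x (l - 1)
  have hunit : IsUnit (1 + p * e) :=
    ((Commute.all _ _).isNilpotent_mul_right ⟨l, hpl⟩).isUnit_one_add
  rwa [he, hx, mul_one, Ne, hunit.mul_left_eq_zero]

theorem IsCrossedHom.map_zpow_ne_zero {H : Type*} [Group H] {c : H →* Aˣ} {f : H → A}
    (hf : IsCrossedHom c f) (hp : p.Prime) (hpl : (p : A) ^ l = 0) (hpl' : (p : A) ^ (l - 1) ≠ 0)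
    (hc : ∀ g, (p : A) ∣ (c g : A) - 1) (hc2 : p = 2 → ∀ g, (4 : A) ∣ (c g : A) - 1) {x : H}
    (hx : f x = 1) {u : ℤ} (hu : IsCoprime (p : ℤ) u) : f (x ^ ((p : ℤ) ^ (l - 1) * u)) ≠ 0 := by
  have hl : l ≠ 0 := by
    rintro rfl
    exact hpl' hpl
  have hL {g : H} : g ∈ hf.congruenceSubgroup 0 1 ↔ f g = 0 := mem_congruenceSubgroup_zero_one
  have hxp : (x ^ p ^ (l - 1)) ^ (p : ℤ) ∈ hf.congruenceSubgroup 0 1 := by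
    rw [zpow_natCast, ← pow_mul, ← pow_succ, Nat.sub_one_add_one hl, hL]
    exact (mem_congruenceSubgroup_zero_zero.1
      (hf.pow_prime_pow_mem_congruenceSubgroup_zero_zero hpl hc x)).1
  intro h
  have hxu : (x ^ p ^ (l - 1)) ^ u ∈ hf.congruenceSubgroup 0 1 := by
    rw [zpow_mul, ← hL] at h
    exact_mod_cast h
  exact hf.map_pow_prime_pow_pred_ne_zero hp hpl hpl' hc hc2 hx
    (hL.1 (mem_of_zpow_mem_of_isCoprime hu hxp hxu))

theorem IsKummerian.map_mul_mul_ne_one [Fact p.Prime] [Finite A] (hG : IsKummerian p l c)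
    (hpl : (p : A) ^ l = 0) (hpl' : (p : A) ^ (l - 1) ≠ 0) (hcc : IsLocallyConstant c)
    (hc : ∀ g, (p : A) ∣ (c g : A) - 1) (hc2 : p = 2 → ∀ g, (4 : A) ∣ (c g : A) - 1)
    {I : Type*} {x : S} {y : I → S} (hS : IsFreeProPGroupOn p fun o : Option I => o.elim x y)
    (hπ : IsMinimalPresentation p π) {u : ℤ} (hu : IsCoprime (p : ℤ) u) {s t : S}
    (hs : s ∈ (Subgroup.closure (Set.range y)).topologicalClosure)
    (ht : t ∈ pDescendingCentralSeries p S (l + 1)) :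
    π (x ^ ((p : ℤ) ^ (l - 1) * u) * s * t) ≠ 1 := by
  intro hr
  have := hS.isProPGroup.compactSpace
  have hcπ (s : S) : (p : A) ∣ (c (π s) : A) - 1 := hc (π s)
  have hccπ : IsLocallyConstant (c.comp π.toMonoidHom) := hcc.comp_continuous π.continuous_toFun
  obtain ⟨f, hf, hfc, hfι⟩ := hS.exists_isCrossedHom hpl hccπ hcπ (fun o => o.elim 1 0) <|
    (Set.finite_singleton none).subset fun o ho => by
      cases o
      · rfl
      · exact absurd rfl ho
  let L := hf.congruenceSubgroup 0 1
  have hL {g : S} : g ∈ L ↔ f g = 0 := IsCrossedHom.mem_congruenceSubgroup_zero_one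
  have hsL : s ∈ L :=
    Subgroup.topologicalClosure_minimal _
      ((Subgroup.closure_le _).2 (Set.range_subset_iff.2 fun i => hL.2 (hfι (some i))))
      (Subgroup.isClosed_of_isOpen _ (hf.isOpen_congruenceSubgroup hfc hccπ 0 1)) hs
  have htL : t ∈ L := hL.2 <| by
    simpa [hpl] using (hf.pDescendingCentralSeries_le_congruenceSubgroup hfc hccπ hcπ l ht).1
  have hrL : x ^ ((p : ℤ) ^ (l - 1) * u) * s * t ∈ L :=
    hL.2 (hG.eq_zero_of_mem_ker hc hπ hf hfc le_rfl (by simp [hpl]) hr)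
  rw [L.mul_mem_cancel_right htL, L.mul_mem_cancel_right hsL] at hrL
  exact hf.map_zpow_ne_zero Fact.out hpl hpl' hcπ (fun h s => hc2 h (π s)) (hfι none) hu (hL.1 hrL)

end Presentation

section MaximalProPQuotient

variable {p : ℕ} {Γ : Type*} [Group Γ] [TopologicalSpace Γ]

theorem isClosed_proPKernel [IsTopologicalGroup Γ] : IsClosed (proPKernel p Γ : Set Γ) := by
  rw [proPKernel, Subgroup.coe_sInf]
  exact isClosed_biInter fun N hN => N.isClosed_of_isOpen hN.2.1

variable [CompactSpace Γ] [IsTopologicalGroup Γ] [Fact p.Prime]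

theorem proPKernel_le {N : Subgroup Γ} [N.Normal] (hN : IsOpen (N : Set Γ))
    (h : ∀ g, ∃ k, g ^ p ^ k ∈ N) : proPKernel p Γ ≤ N := by
  have := N.quotient_finite_of_isOpen hN
  have hp : IsPGroup p (Γ ⧸ N) := QuotientGroup.mk_surjective.forall.2 fun g =>
    (h g).imp fun k hk => (QuotientGroup.eq_one_iff (g ^ p ^ k)).2 hk
  refine sInf_le ⟨‹_›, hN, ?_⟩
  rw [Subgroup.index_eq_card]
  exact IsPGroup.iff_card.1 hp

variable {A : Type*} [CommRing A] {l : ℕ} {c : Γ →* Aˣ}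

theorem IsCrossedHom.proPKernel_le_congruenceSubgroup {f : Γ → A} (hf : IsCrossedHom c f)
    (hfc : IsLocallyConstant f) (hcc : IsLocallyConstant c) (hpl : (p : A) ^ l = 0)
    (hc : ∀ g, (p : A) ∣ (c g : A) - 1) : proPKernel p Γ ≤ hf.congruenceSubgroup 0 0 :=
  have := hf.normal_congruenceSubgroup (dvd_refl (0 : A))
  proPKernel_le (hf.isOpen_congruenceSubgroup hfc hcc 0 0) fun g =>
    ⟨l, hf.pow_prime_pow_mem_congruenceSubgroup_zero_zero hpl hc g⟩

theorem MaximalProPQuotient.exists_descend_character (hcc : IsLocallyConstant c)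
    (hpl : (p : A) ^ l = 0) (hc : ∀ g, (p : A) ∣ (c g : A) - 1) :
    ∃ c' : MaximalProPQuotient p Γ →* Aˣ,
      IsLocallyConstant c' ∧ c'.comp (QuotientGroup.mk' _) = c := by
  have h0 : IsCrossedHom c (0 : Γ → A) := fun _ _ => by simp
  have hker : proPKernel p Γ ≤ c.ker := fun g hg =>
    (IsCrossedHom.mem_congruenceSubgroup_zero_zero.1 <|
      h0.proPKernel_le_congruenceSubgroup (IsLocallyConstant.const 0) hcc hpl hc hg).2
  exact ⟨QuotientGroup.lift _ c hker, fun U => (QuotientGroup.isQuotientMap_mk _).isOpen_preimage.1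
    (hcc U), MonoidHom.ext fun _ => rfl⟩

theorem IsKummerian.of_comp_mk' {c : MaximalProPQuotient p Γ →* Aˣ}
    (hΓ : IsKummerian p l (c.comp (QuotientGroup.mk' (proPKernel p Γ)))) (hcc : IsLocallyConstant c)
    (hpl : (p : A) ^ l = 0) (hc : ∀ g, (p : A) ∣ (c g : A) - 1) : IsKummerian p l c := by
  intro χ hχ hχc hχp
  have hmk : Continuous (QuotientGroup.mk' (proPKernel p Γ)) := continuous_quot_mk
  obtain ⟨κ, hκ, hκc, hκχ⟩ := hΓ (χ ∘ QuotientGroup.mk' _) (hχ.comp (QuotientGroup.mk' _))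
    (hχc.comp_continuous hmk) fun g => hχp g
  obtain ⟨κ', hκ', hκc', h⟩ := hκ.exists_descend hκc (QuotientGroup.isQuotientMap_mk _) fun g hg =>
    (IsCrossedHom.mem_congruenceSubgroup_zero_zero.1 <|
      hκ.proPKernel_le_congruenceSubgroup hκc (hcc.comp_continuous hmk) hpl (fun g => hc g)
        ((QuotientGroup.eq_one_iff g).1 hg)).1
  exact ⟨κ', hκ', hκc', QuotientGroup.mk_surjective.forall.2 fun g =>
    (congrArg _ (h g)).trans (hκχ g)⟩

end MaximalProPQuotient

theorem isLocallyConstant_smul {G X : Type*} [Group G] [TopologicalSpace G] [IsTopologicalGroup G]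
    [MulAction G X] {x : X} (hx : IsOpen (MulAction.stabilizer G x : Set G)) :
    IsLocallyConstant fun g : G => g • x :=
  (IsLocallyConstant.iff_exists_open _).2 fun g =>
    ⟨(g⁻¹ * ·) ⁻¹' MulAction.stabilizer G x, hx.preimage (continuous_const_mul _),
      by simp, fun h hh => inv_smul_eq_iff.1 ((mul_smul _ _ _).symm.trans hh)⟩

-- With `g = gcd(a, n)`, the element `n / g` annihilates `a`, hence `b`, so that `g` divides `b`.
theorem zmod_dvd_of_forall_mul_eq_zero {n : ℕ} [NeZero n] {a b : ZMod n}
    (h : ∀ d, a * d = 0 → b * d = 0) : a ∣ b := by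
  let g := a.val.gcd n
  obtain ⟨d, hd⟩ : g ∣ n := a.val.gcd_dvd_right n
  have hd0 : 0 < d := Nat.pos_of_ne_zero fun h0 => NeZero.ne n (by rw [hd, h0, mul_zero])
  have hbd : b * d = 0 := h d <| by
    rw [← ZMod.natCast_zmod_val a, ← Nat.cast_mul, ZMod.natCast_eq_zero_iff]
    conv_lhs => rw [hd]
    exact mul_dvd_mul_right (a.val.gcd_dvd_left n) d
  have hgb : g ∣ b.val := by
    rw [← ZMod.natCast_zmod_val b, ← Nat.cast_mul, ZMod.natCast_eq_zero_iff] at hbd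
    exact Nat.dvd_of_mul_dvd_mul_right hd0 (hd ▸ hbd)
  have hag : a ∣ g := ⟨a⁻¹, (ZMod.mul_inv_eq_gcd a).symm⟩
  rw [← ZMod.natCast_zmod_val b]
  exact hag.trans (Nat.cast_dvd_cast hgb)

section Galois

variable {F K : Type*} [Field F] [Field K] [Algebra F K]

-- A character with values in `Fˣ` is a `1`-cocycle with values in `Kˣ`, so Hilbert 90 applies.
theorem exists_eigenvector_of_finiteDimensional [FiniteDimensional F K] (χ : Gal(K/F) →* Fˣ) :
    ∃ γ : Kˣ, ∀ σ : Gal(K/F), σ (γ : K) = algebraMap F K (χ σ) * γ := by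
  let f (σ : Gal(K/F)) : Kˣ := Units.map (algebraMap F K) (χ σ)
  have hf : groupCohomology.IsMulCocycle₁ f := fun σ τ => by
    have h : σ • f τ = f τ := Units.ext (σ.commutes _)
    rw [h, mul_comm, ← map_mul, ← map_mul]
  obtain ⟨γ, hγ⟩ := groupCohomology.isMulCoboundary₁_of_isMulCocycle₁_of_aut_to_units f hf
  exact ⟨γ, fun σ => congrArg Units.val (div_eq_iff_eq_mul.1 (hγ σ))⟩

theorem exists_eigenvector_of_isLocallyConstant [IsGalois F K] {χ : Gal(K/F) →* Fˣ}
    (hχ : IsLocallyConstant χ) :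
    ∃ γ : Kˣ, ∀ σ : Gal(K/F), σ (γ : K) = algebraMap F K (χ σ) * γ := by
  have hopen : IsOpen (χ.ker : Set Gal(K/F)) := hχ {1}
  let L : IntermediateField F K := IntermediateField.fixedField χ.ker
  have hL : L.fixingSubgroup = χ.ker :=
    InfiniteGalois.fixingSubgroup_fixedField ⟨χ.ker, χ.ker.isClosed_of_isOpen hopen⟩
  have : FiniteDimensional F L :=
    (InfiniteGalois.isOpen_iff_finite L).1 (by rw [hL]; exact hopen)
  have : IsGalois F L := (InfiniteGalois.normal_iff_isGalois L).1 (by rw [hL]; infer_instance)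
  let res : Gal(K/F) →* Gal(L/F) := AlgEquiv.restrictNormalHom L
  have hres : Function.Surjective res := AlgEquiv.restrictNormalHom_surjective K
  have hker : res.ker ≤ χ.ker := by rw [IntermediateField.restrictNormalHom_ker, hL]
  obtain ⟨γ, hγ⟩ := exists_eigenvector_of_finiteDimensional
    (MonoidHom.liftOfSurjective res hres ⟨χ, hker⟩)
  refine ⟨Units.map (algebraMap L K) γ, fun σ => ?_⟩
  have h := congrArg (algebraMap L K) (hγ (res σ))
  rw [show _ = χ σ from MonoidHom.liftOfRightInverse_comp_apply _ _ _ ⟨χ, hker⟩ σ, map_mul] at h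
  exact (AlgEquiv.restrictNormal_commutes σ L _).symm.trans h

variable {n : ℕ} [NeZero n] {ζ : K}

theorem zmodChar_injective (hζ : IsPrimitiveRoot ζ n) :
    Function.Injective (AddChar.zmodChar n hζ.pow_eq_one) := fun a b hab => by
  rw [AddChar.zmodChar_apply, AddChar.zmodChar_apply] at hab
  exact ZMod.val_injective n (hζ.pow_inj a.val_lt b.val_lt hab)

theorem exists_zmodChar_eq (hζ : IsPrimitiveRoot ζ n) {w : K} (hw : w ^ n = 1) :
    ∃ a, AddChar.zmodChar n hζ.pow_eq_one a = w := by
  obtain ⟨i, -, hi⟩ := hζ.eq_pow_of_pow_eq_one hw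
  exact ⟨i, by rw [AddChar.zmodChar_apply', hi]⟩

theorem map_zmodChar (hζ : IsPrimitiveRoot ζ n) (σ : Gal(K/F)) (a : ZMod n) :
    σ (AddChar.zmodChar n hζ.pow_eq_one a) =
      AddChar.zmodChar n hζ.pow_eq_one (hζ.autToPow F σ * a) := by
  rw [← ZMod.natCast_zmod_val (hζ.autToPow F σ : ZMod n), ← nsmul_eq_mul,
    AddChar.map_nsmul_eq_pow, AddChar.zmodChar_apply, map_pow, ← hζ.autToPow_spec F σ, ← pow_mul,
    ← pow_mul, mul_comm]

theorem mem_range_algebraMap_of_pow_eq_one {m : ℕ} [NeZero m] {z : F} (hz : IsPrimitiveRoot z m)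
    {w : K} (hw : w ^ m = 1) : w ∈ (algebraMap F K).range := by
  obtain ⟨i, -, rfl⟩ :=
    (hz.map_of_injective (algebraMap F K).injective).eq_pow_of_pow_eq_one hw
  exact pow_mem (RingHom.mem_range_self _ z) i

theorem isLocallyConstant_autToPow [Algebra.IsIntegral F K] (hζ : IsPrimitiveRoot ζ n) :
    IsLocallyConstant (hζ.autToPow F) := by
  refine IsLocallyConstant.desc _ (fun a => AddChar.zmodChar n hζ.pow_eq_one (a : ZMod n)) ?_
    ((zmodChar_injective hζ).comp Units.val_injective)
  have hσ : IsLocallyConstant fun σ : Gal(K/F) => σ ζ :=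
    isLocallyConstant_smul (stabilizer_isOpen_of_isIntegral (K := F) ζ)
  convert hσ using 2 with σ
  exact hζ.autToPow_spec F σ

theorem natCast_dvd_autToPow_sub_one (hζ : IsPrimitiveRoot ζ n) {m : ℕ} [NeZero m] {z : F}
    (hz : IsPrimitiveRoot z m) (σ : Gal(K/F)) :
    (m : ZMod n) ∣ (hζ.autToPow F σ : ZMod n) - 1 := by
  refine zmod_dvd_of_forall_mul_eq_zero fun d hd => ?_
  obtain ⟨w, hw⟩ : AddChar.zmodChar n hζ.pow_eq_one d ∈ (algebraMap F K).range :=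
    mem_range_algebraMap_of_pow_eq_one hz <| by
      rw [← AddChar.map_nsmul_eq_pow, nsmul_eq_mul, hd, AddChar.map_zero_eq_one]
  rw [sub_one_mul, sub_eq_zero]
  apply zmodChar_injective hζ
  rw [← map_zmodChar, ← hw, AlgEquiv.commutes]

theorem exists_kummer_isCrossedHom [Algebra.IsIntegral F K] (hζ : IsPrimitiveRoot ζ n) {α : K}
    (hα : α ≠ 0) (hαn : ∀ σ : Gal(K/F), σ (α ^ n) = α ^ n) :
    ∃ κ : Gal(K/F) → ZMod n, IsCrossedHom (hζ.autToPow F) κ ∧ IsLocallyConstant κ ∧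
      ∀ σ, σ α = AddChar.zmodChar n hζ.pow_eq_one (κ σ) * α := by
  have hroot (σ : Gal(K/F)) : (σ α / α) ^ n = 1 := by
    rw [div_pow, ← map_pow, hαn, div_self (pow_ne_zero n hα)]
  choose κ hκ using fun σ => exists_zmodChar_eq hζ (hroot σ)
  have hκα (σ : Gal(K/F)) : σ α = AddChar.zmodChar n hζ.pow_eq_one (κ σ) * α := by
    rw [hκ, div_mul_cancel₀ _ hα]
  refine ⟨κ, fun σ τ => zmodChar_injective hζ (mul_right_cancel₀ hα ?_), ?_, hκα⟩
  · rw [← hκα, AlgEquiv.mul_apply, hκα τ, map_mul, map_zmodChar hζ, hκα σ, AddChar.map_add_eq_mul]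
    ring
  · have hσ : IsLocallyConstant fun σ : Gal(K/F) => σ α :=
      isLocallyConstant_smul (stabilizer_isOpen_of_isIntegral (K := F) α)
    refine IsLocallyConstant.desc κ (fun a => AddChar.zmodChar n hζ.pow_eq_one a * α) ?_
      ((mul_left_injective₀ hα).comp (zmodChar_injective hζ))
    convert hσ using 2 with σ
    exact (hκα σ).symm

theorem exists_eigenvector_of_isCrossedHom_one [IsGalois F K] (hζ : IsPrimitiveRoot ζ n) {m : ℕ}
    [NeZero m] {z : F} (hz : IsPrimitiveRoot z m) {χ : Gal(K/F) → ZMod n} (hχ : IsCrossedHom 1 χ)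
    (hχc : IsLocallyConstant χ) (hχm : ∀ σ, m * χ σ = 0) :
    ∃ γ : Kˣ, ∀ σ : Gal(K/F), σ (γ : K) = AddChar.zmodChar n hζ.pow_eq_one (χ σ) * γ := by
  have hF (σ : Gal(K/F)) : AddChar.zmodChar n hζ.pow_eq_one (χ σ) ∈ (algebraMap F K).range :=
    mem_range_algebraMap_of_pow_eq_one hz <| by
      rw [← AddChar.map_nsmul_eq_pow, nsmul_eq_mul, hχm, AddChar.map_zero_eq_one]
  choose v hv using hF
  let ψ : Gal(K/F) →* F :=
    { toFun := v
      map_one' := (algebraMap F K).injective <| by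
        rw [hv, hχ.map_one, AddChar.map_zero_eq_one, map_one]
      map_mul' := fun σ τ => (algebraMap F K).injective <| by
        rw [map_mul, hv, hv, hv, hχ σ τ, MonoidHom.one_apply, Units.val_one, one_mul,
          AddChar.map_add_eq_mul] }
  have hψ : IsLocallyConstant ψ.toHomUnits := by
    refine IsLocallyConstant.desc _ (fun a => algebraMap F K a) ?_
      ((algebraMap F K).injective.comp Units.val_injective)
    convert hχc.comp (AddChar.zmodChar n hζ.pow_eq_one) using 1
    exact funext hv
  obtain ⟨γ, hγ⟩ := exists_eigenvector_of_isLocallyConstant hψ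
  exact ⟨γ, fun σ => (hγ σ).trans (congrArg (· * _) (hv σ))⟩

-- If `σ γ = ζ ^ χ(σ) * γ` for all `σ` and `α ^ p ^ (l - 1) = γ`, then `α ^ p ^ l` lies in `F` and
-- its Kummer cocycle lifts `χ`.
theorem isKummerian_autToPow [IsGalois F K] [IsSepClosed K] {p l : ℕ} [NeZero p] {z : F}
    (hz : IsPrimitiveRoot z p) (hl : l ≠ 0) (hζ : IsPrimitiveRoot ζ (p ^ l)) :
    IsKummerian p l (hζ.autToPow F) := by
  intro χ hχ hχc hχp
  obtain ⟨γ, hγ⟩ := exists_eigenvector_of_isCrossedHom_one hζ hz hχ hχc hχp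
  have : NeZero (p : K) := (hz.map_of_injective (algebraMap F K).injective).neZero'
  have : NeZero ((p ^ (l - 1) : ℕ) : K) := ⟨by simpa using fun h => absurd h (NeZero.ne _)⟩
  obtain ⟨α, hα⟩ := IsSepClosed.exists_pow_nat_eq (γ : K) (p ^ (l - 1))
  have hα0 : α ≠ 0 := fun h => γ.ne_zero (by rw [← hα, h, zero_pow (NeZero.ne _)])
  have hαn (σ : Gal(K/F)) : σ (α ^ p ^ l) = α ^ p ^ l := by
    rw [← Nat.sub_one_add_one hl, pow_succ, pow_mul, hα, map_pow, hγ, mul_pow,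
      ← AddChar.map_nsmul_eq_pow, nsmul_eq_mul, hχp, AddChar.map_zero_eq_one, one_mul]
  obtain ⟨κ, hκ, hκc, hκα⟩ := exists_kummer_isCrossedHom hζ hα0 hαn
  refine ⟨κ, hκ, hκc, fun σ => zmodChar_injective hζ (mul_right_cancel₀ γ.ne_zero ?_)⟩
  rw [← hγ, ← hα, map_pow, hκα, mul_pow, ← AddChar.map_nsmul_eq_pow, nsmul_eq_mul, Nat.cast_pow]

end Galois

section RootsOfUnityCondition

variable {p : ℕ} {F : Type*} [Field F]

theorem RootsOfUnityCondition.exists_isPrimitiveRoot (hF : RootsOfUnityCondition p F) :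
    ∃ z : F, IsPrimitiveRoot z p := by
  by_cases h2 : p = 2
  · subst h2
    obtain ⟨z, hz⟩ := hF.2 rfl
    exact ⟨z ^ 2, hz.pow four_pos (by norm_num)⟩
  · exact hF.1 h2

theorem RootsOfUnityCondition.exists_isKummerian_character [Fact p.Prime]
    (hF : RootsOfUnityCondition p F) {l : ℕ} (hl : l ≠ 0) :
    ∃ c : maximalProPGaloisGroup p F →* (ZMod (p ^ l))ˣ,
      IsLocallyConstant c ∧ IsKummerian p l c ∧
      (∀ g, (p : ZMod (p ^ l)) ∣ (c g : ZMod (p ^ l)) - 1) ∧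
      (p = 2 → ∀ g, (4 : ZMod (p ^ l)) ∣ (c g : ZMod (p ^ l)) - 1) := by
  obtain ⟨z, hz⟩ := hF.exists_isPrimitiveRoot
  have : NeZero (p : F) := hz.neZero'
  obtain ⟨ζ, hζ⟩ :=
    HasEnoughRootsOfUnity.exists_primitiveRoot (SeparableClosure F) (p ^ l)
  have hpl : (p : ZMod (p ^ l)) ^ l = 0 := by rw [← Nat.cast_pow, ZMod.natCast_self]
  have hpc := natCast_dvd_autToPow_sub_one (F := F) hζ hz
  obtain ⟨c, hcc, hc⟩ := MaximalProPQuotient.exists_descend_character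
    (isLocallyConstant_autToPow (F := F) hζ) hpl hpc
  have hcσ (σ : Gal(SeparableClosure F/F)) : c (QuotientGroup.mk' _ σ) = hζ.autToPow F σ :=
    DFunLike.congr_fun hc σ
  have hpc' : ∀ g, (p : ZMod (p ^ l)) ∣ (c g : ZMod (p ^ l)) - 1 :=
    QuotientGroup.mk_surjective.forall.2 fun σ => hcσ σ ▸ hpc σ
  refine ⟨c, hcc, .of_comp_mk' (hc ▸ isKummerian_autToPow hz hl hζ) hcc hpl hpc', hpc',
    fun h2 => QuotientGroup.mk_surjective.forall.2 fun σ => ?_⟩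
  obtain ⟨i, hi⟩ := hF.2 h2
  exact hcσ σ ▸ mod_cast natCast_dvd_autToPow_sub_one hζ hi σ

end RootsOfUnityCondition

theorem theorem3p9_general (p : ℕ) [Fact p.Prime] (F : Type*) [Field F]
    (hF : RootsOfUnityCondition p F)
    (S : Type*) [Group S] [TopologicalSpace S] [IsTopologicalGroup S]
    (I : Type*) (x : S) (y : I → S)
    (hS : IsFreeProPGroupOn p (fun o : Option I => o.elim x y))
    (π : S →ₜ* maximalProPGaloisGroup p F) (hπ : IsMinimalPresentation p π)
    {l : ℕ} (hl : l ≠ 0) {u : ℤ} (hu : IsCoprime (p : ℤ) u) {s t : S}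
    (hs : s ∈ (Subgroup.closure (Set.range y)).topologicalClosure)
    (ht : t ∈ pDescendingCentralSeries p S (l + 1)) :
    π (x ^ ((p : ℤ) ^ (l - 1) * u) * s * t) ≠ 1 := by
  obtain ⟨c, hcc, hc, hpc, hc2⟩ := hF.exists_isKummerian_character hl
  have : IsClosed (proPKernel p Gal(SeparableClosure F/F) : Set Gal(SeparableClosure F/F)) :=
    isClosed_proPKernel
  have hpl : (p : ZMod (p ^ l)) ^ l = 0 := by rw [← Nat.cast_pow, ZMod.natCast_self]
  have hpl' : (p : ZMod (p ^ l)) ^ (l - 1) ≠ 0 := by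
    rw [← Nat.cast_pow, Ne, ZMod.natCast_eq_zero_iff,
      Nat.pow_dvd_pow_iff_le_right (Fact.out : p.Prime).one_lt]
    lia
  exact hc.map_mul_mul_ne_one hpl hpl' hcc hpc hc2 hS hπ hu hs ht

theorem theorem3p9 (p : ℕ) [Fact p.Prime] (F : Type*) [Field F]
    (hF : RootsOfUnityCondition p F)
    (S : Type*) [Group S] [TopologicalSpace S] [IsTopologicalGroup S]
    (I : Type*) (x : S) (y : I → S)
    (hS : IsFreeProPGroupOn p (fun o : Option I => o.elim x y))
    (π : S →ₜ* maximalProPGaloisGroup p F) (hπ : IsMinimalPresentation p π)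
    (T : Subgroup S) (hT : T = (Subgroup.closure (Set.range y)).topologicalClosure) :
    ¬ ∃ (l : ℕ) (u : ℤ) (s t : S), 2 ≤ l ∧ Int.gcd p u = 1 ∧
      s ∈ closedCommutator T T ∧
      t ∈ pDescendingCentralSeries p S (l + 1) ⊓ closedCommutator ⊤ ⊤ ∧
      π (x ^ ((p : ℤ) ^ (l - 1) * u) * s * t) = 1 := by
  rintro ⟨l, u, s, t, hl, hu, hs, ⟨ht, -⟩, hr⟩
  have hsT : s ∈ (Subgroup.closure (Set.range y)).topologicalClosure :=
    closedCommutator_le (Subgroup.isClosed_topologicalClosure _) (Subgroup.commutator_le_self _)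
      (hT ▸ hs)
  exact theorem3p9_general p F hF S I x y hS π hπ (by lia) (Int.isCoprime_iff_gcd_eq_one.2 hu) hsT
    ht hr
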